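/- For a prime $p$ and an integer $k\ge 1$, call a subset $A\subseteq\mathbb F_p$ \emph{$S_k$-type} if for every $a\in A$ there is $d\in\mathbb F_p\setminus\{0\}$ with $a+id\in A$ for all integers $-k\le i\le k$. Call $A$ \emph{$N_k$-type} if it is $S_k$-type and, in addition, for every $a\in\mathbb F_p\setminus A$ there is $d\in\mathbb F_p\setminus\{0\}$ with $a+id\in A$ for all $1\le i\le k$. Let $S_k(p)$ and $N_k(p)$ denote the smallest size of a nonempty $S_k$-type, respectively nonempty $N_k$-type, subset of $\mathbb F_p$. For $v\in\mathbb F_p^n$ let $g^v$ denote the corresponding basis element of the group ring $\mathbb F_p[\mathbb F_p^n]$ of the additive group $\mathbb F_p^n$ (so $g^vg^w=g^{v+w}$), and let $e_1,\dots,e_n$ be the standard basis vectors of $\mathbb F_p^n$. (i) Let $p$ be a prime and $k$ an integer with $p>k\ge 1$ and $N_k(p)\cdot S_k(p)<p-1$. Let $M$ be a nonsingular $n\times n$ matrix over $\mathbb F_p$ with rows $a_1,\dots,a_n$. Then $$\prod_{i=1}^n(1-g^{e_i})^k\cdot\prod_{i=1}^n(1-g^{a_i})^k\neq 0\quad\text{in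 } \mathbb F_p[\mathbb F_p^n].$$ (ii) Let $p$ be a prime with $61<p\neq 79$, let $M$ be a nonsingular $n\times n$ matrix over $\mathbb F_p$, and let $c_1,\dots,c_n,d_1,\dots,d_n\in\mathbb F_p$ be arbitrary. Then there is a vector $x\in\mathbb F_p^n$ such that $x_i\neq c_i$ and $(Mx)_i\neq d_i$ for all $1\le i\le n$. In particular (taking all $c_i=d_i=0$), the Alon–Jaeger–Tarsi conjecture holds over $\mathbb F_p$ for these primes: there is $x$ such that both $x$ and $Mx$ have only nonzero entries. (iii) There is a universal constant $K$ such that the following holds. Let $k\ge 2$ be an integer, $p$ a prime with $p>k^{Kk}$, and $M$ a nonsingular $n\times n$ matrix over $\mathbb F_p$. For each $1\le i\le n$ let $c_{i,1},\dots,c_{i,k}\in\mathbb F_p$ be $k$ different residues and let $d_{i,1},\dots,d_{i,k}\in\mathbb F_p$ be $k$ different residues. Then there is a vector $x\in\mathbb F_p^n$ such that $x_i\neq c_{i,\ell}$ and $(Mx)_i\neq d_{i,\ell}$ for all $1\le i\le n$ and $1\le\ell\le k$. -/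

import Mathlib

namespace AJT

/-- `A ⊆ 𝔽_p` is of `S_k`-type: every element of `A` is the middle term of a nonconstant
`(2k+1)`-term arithmetic progression contained in `A`. -/
def IsSType (k : ℕ) {p : ℕ} (A : Finset (ZMod p)) : Prop :=
  ∀ a ∈ A, ∃ d : ZMod p, d ≠ 0 ∧
    ∀ i : ℤ, -(k : ℤ) ≤ i → i ≤ (k : ℤ) → a + (i : ZMod p) * d ∈ A

/-- `A ⊆ 𝔽_p` is of `N_k`-type: it is of `S_k`-type, and for every `a ∉ A` there is a nonzero `d`
with `a + d, a + 2d, …, a + kd ∈ A`. -/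
def IsNType (k : ℕ) {p : ℕ} (A : Finset (ZMod p)) : Prop :=
  IsSType k A ∧
    ∀ a ∉ A, ∃ d : ZMod p, d ≠ 0 ∧
      ∀ i : ℤ, 1 ≤ i → i ≤ (k : ℤ) → a + (i : ZMod p) * d ∈ A

/-- `S_k(p)`: the least size of a nonempty `S_k`-type subset of `𝔽_p`
(for `p` prime, `𝔽_p` itself is such a subset). -/
noncomputable def S (k p : ℕ) : ℕ :=
  sInf {m : ℕ | ∃ A : Finset (ZMod p), A.Nonempty ∧ IsSType k A ∧ A.card = m}

/-- `N_k(p)`: the least size of a nonempty `N_k`-type subset of `𝔽_p`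
(for `p` prime, `𝔽_p` itself is such a subset). -/
noncomputable def N (k p : ℕ) : ℕ :=
  sInf {m : ℕ | ∃ A : Finset (ZMod p), A.Nonempty ∧ IsNType k A ∧ A.card = m}

/-- The group ring `𝔽_p[𝔽_p^n]` of the additive group `𝔽_p^n`. -/
abbrev GroupRing (p n : ℕ) : Type := AddMonoidAlgebra (ZMod p) (Fin n → ZMod p)

/-- The basis element `g^v` of the group ring, for `v ∈ 𝔽_p^n`. -/
noncomputable def g {p n : ℕ} (v : Fin n → ZMod p) : GroupRing p n :=
  AddMonoidAlgebra.single v 1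

end AJT

/-!
Multiplying by a factor `∏_l (1 - ψ(-c_l) g^v)` spreads the support of an element of the group ring
only along `v`. Hence, in a vanishing product of such factors that contains all the `b`-factors and
is minimal, the progressions inside the `S_k`- and `N_k`-type sets let one exchange summands: the
box of all sums `∑ z_i v_i`, with every `z_i` in its set `A` or `B`, is invariant under translation
by the span `U` of the `a`-vectors that occur. If every vector has at most `r` factors and
`D = dim U`, the `a`-part of a sum takes at most `|A| ^ (r D)` values, while for a point of a fixed
coset of `U` the independent `b`-vectors leave only `D` free coordinates, hence at most
`|B| ^ (r D)` values for the `b`-part. So `p ^ D ≤ (|A| |B|) ^ (r D)`, impossible for small sets.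

With `ψ` the standard character of `𝔽_p`, a nonzero product over `ℂ` has a nonzero Fourier
coefficient, and its frequency is a functional `f` with `f v ≠ c_l` for all the factors.
-/

namespace AJT

open Finset AddMonoidAlgebra Module

section BoxSum

/-- The sumset `∑_{i ∈ s} A_i • v_i` of dilates of the vectors `v_i`. The scalars may come from `ℕ`,
where exponents live, or from a field. -/
def boxSum {K V ι : Type*} [AddCommMonoid V] [SMul K V] (A : ι → Set K) (v : ι → V)
    (s : Finset ι) : Set V :=
  {x | ∃ z : ι → K, (∀ i ∈ s, z i ∈ A i) ∧ ∑ i ∈ s, z i • v i = x}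

variable {K V ι κ : Type*}

theorem boxSum_empty [AddCommMonoid V] [SMul K V] [Nonempty K] (A : ι → Set K) (v : ι → V) :
    boxSum A v ∅ = {0} := by
  ext x
  simp [boxSum, eq_comm]

theorem smul_add_mem_boxSum_insert [AddCommMonoid V] [SMul K V] [DecidableEq ι] {A : ι → Set K}
    {v : ι → V} {s : Finset ι} {j : ι} (hj : j ∉ s) {a : K} (ha : a ∈ A j) {x : V}
    (hx : x ∈ boxSum A v s) : a • v j + x ∈ boxSum A v (insert j s) := by
  obtain ⟨z, hz, rfl⟩ := hx
  have hne : ∀ i ∈ s, i ≠ j := fun i hi h => hj (h ▸ hi)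
  refine ⟨Function.update z j a, fun i hi => ?_, ?_⟩
  · obtain rfl | hi := mem_insert.mp hi
    · simpa using ha
    · simpa [hne i hi] using hz i hi
  · rw [sum_insert hj, Function.update_self]
    exact congrArg _ (sum_congr rfl fun i hi => by rw [Function.update_of_ne (hne i hi)])

theorem exists_smul_add_of_mem_boxSum_insert [AddCommMonoid V] [SMul K V] [DecidableEq ι]
    {A : ι → Set K} {v : ι → V} {s : Finset ι} {j : ι} (hj : j ∉ s) {x : V}
    (hx : x ∈ boxSum A v (insert j s)) :
    ∃ a ∈ A j, ∃ y ∈ boxSum A v s, a • v j + y = x := by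
  obtain ⟨z, hz, rfl⟩ := hx
  exact ⟨z j, hz j (mem_insert_self j s), _, ⟨z, fun i hi => hz i (mem_insert_of_mem hi), rfl⟩,
    by rw [sum_insert hj]⟩

theorem boxSum_nonempty [AddCommMonoid V] [SMul K V] {A : ι → Set K} (hA : ∀ i, (A i).Nonempty)
    (v : ι → V) (s : Finset ι) : (boxSum A v s).Nonempty := by
  choose z hz using hA
  exact ⟨_, z, fun i _ => hz i, rfl⟩

theorem boxSum_subset_span {R : Type*} [Semiring R] [AddCommMonoid V] [Module R V] [SMul K R]
    [SMul K V] [IsScalarTower K R V] (A : ι → Set K) (v : ι → V) (s : Finset ι) :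
    boxSum A v s ⊆ Submodule.span R (v '' s) := by
  rintro _ ⟨z, -, rfl⟩
  exact Submodule.sum_mem _ fun i hi =>
    Submodule.smul_of_tower_mem _ _ (Submodule.subset_span (Set.mem_image_of_mem v hi))

theorem boxSum_subset_image_piFinset [AddCommMonoid V] [SMul K V] [DecidableEq ι] [DecidableEq V]
    (A : Finset K) (v : ι → V) (s : Finset ι) :
    boxSum (fun _ => (A : Set K)) v s ⊆
      (Fintype.piFinset fun _ : s => A).image fun z : s → K => ∑ i, z i • v i := by
  rintro _ ⟨z, hz, rfl⟩
  refine mem_image.mpr ⟨fun i => z i, Fintype.mem_piFinset.mpr fun i => hz i i.2, ?_⟩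
  exact sum_coe_sort s fun i => z i • v i

theorem finite_boxSum [AddCommMonoid V] [SMul K V] (A : Finset K) (v : ι → V) (s : Finset ι) :
    (boxSum (fun _ => (A : Set K)) v s).Finite := by
  classical exact (finite_toSet _).subset (boxSum_subset_image_piFinset A v s)

theorem ncard_boxSum_le [AddCommMonoid V] [SMul K V] (A : Finset K) (v : ι → V) (s : Finset ι) :
    (boxSum (fun _ => (A : Set K)) v s).ncard ≤ #A ^ #s := by
  classical
  calc (boxSum (fun _ => (A : Set K)) v s).ncard
      ≤ #((Fintype.piFinset fun _ : s => A).image fun z : s → K => ∑ i, z i • v i) := by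
        rw [← Set.ncard_coe_finset]
        exact Set.ncard_le_ncard (boxSum_subset_image_piFinset A v s)
    _ ≤ #(Fintype.piFinset fun _ : s => A) := card_image_le
    _ = #A ^ #s := by simp

theorem exists_add_of_mem_boxSum_disjSum [AddCommMonoid V] [SMul K V] {A : ι ⊕ κ → Set K}
    {v : ι ⊕ κ → V} {s : Finset ι} {t : Finset κ} {x : V}
    (hx : x ∈ boxSum A v (s.disjSum t)) :
    ∃ y ∈ boxSum (A ∘ Sum.inl) (v ∘ Sum.inl) s, ∃ z ∈ boxSum (A ∘ Sum.inr) (v ∘ Sum.inr) t,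
      y + z = x := by
  obtain ⟨a, ha, rfl⟩ := hx
  exact ⟨_, ⟨a ∘ Sum.inl, fun i hi => ha _ (inl_mem_disjSum.mpr hi), rfl⟩,
    _, ⟨a ∘ Sum.inr, fun i hi => ha _ (inr_mem_disjSum.mpr hi), rfl⟩,
    by simp only [sum_disjSum, Function.comp_apply]⟩

open scoped Pointwise in
theorem boxSum_comp_fst_subset [Semiring K] [DecidableEq K] [AddCommMonoid V] [Module K V]
    {β : Type*} [Fintype κ] [Fintype β] (B : Finset K) (w : κ → V) :
    boxSum (fun _ => (B : Set K)) (fun x : κ × β => w x.1) univ ⊆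
      boxSum (fun _ => ((Fintype.card β • B : Finset K) : Set K)) w univ := by
  rintro _ ⟨z, hz, rfl⟩
  refine ⟨fun j => ∑ b, z (j, b), fun j _ => ?_, ?_⟩
  · rw [coe_nsmul, ← card_univ, ← sum_const]
    exact Set.finsetSum_mem_finsetSum _ _ _ fun b _ => hz _ (mem_univ _)
  · simp only [sum_smul, Fintype.sum_prod_type]

end BoxSum

section AvoidFactor

/-- The twisted factor `∏_l (1 - ψ(-c_l) g^v)` of the group ring. For trivial `ψ` it is a power of
`1 - g^v`; in general it is killed by `g^u ↦ ψ (f u)` as soon as `f v` is one of the `c_l`. -/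
noncomputable def avoidFactor {R V α : Type*} [CommRing R] [AddCommMonoid V] [Fintype α] {p : ℕ}
    (ψ : AddChar (ZMod p) R) (c : α → ZMod p) (v : V) : AddMonoidAlgebra R V :=
  ∏ l, (1 - single v (ψ (-c l)))

variable {R V ι α : Type*} [CommRing R] [AddCommGroup V]

theorem coeff_one_sub_single_mul (a : R) (v u : V) (F : AddMonoidAlgebra R V) :
    ((1 - single v a) * F).coeff u = F.coeff u - a * F.coeff (u - v) := by
  have h := coeff_single_mul_add F a v (u - v)
  rw [sub_mul, one_mul, coeff_sub, Finsupp.sub_apply, ← h, add_sub_cancel]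

theorem coeff_prod_one_sub_single_mul (s : Finset α) (a : α → R) (v : V)
    (F : AddMonoidAlgebra R V) (u : V) (h : ∀ m, 1 ≤ m → m ≤ #s → F.coeff (u - m • v) = 0) :
    ((∏ l ∈ s, (1 - single v (a l))) * F).coeff u = F.coeff u := by
  classical
  induction s using Finset.induction_on generalizing u with
  | empty => simp
  | insert l s hl ih =>
    rw [card_insert_of_notMem hl] at h
    have hu := ih u fun m hm₁ hm => h m hm₁ (by lia)
    have huv := ih (u - v) fun m _ hm => by
      rw [sub_sub, ← succ_nsmul']
      exact h (m + 1) (by lia) (by lia)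
    have hFuv : F.coeff (u - v) = 0 := by simpa using h 1 le_rfl (by lia)
    rw [prod_insert hl, mul_assoc, coeff_one_sub_single_mul, hu, huv, hFuv, mul_zero, sub_zero]

variable {p : ℕ} [Fintype α] (ψ : AddChar (ZMod p) R)

theorem avoidFactor_one (c : α → ZMod p) (v : V) :
    avoidFactor (1 : AddChar (ZMod p) R) c v = (1 - single v 1) ^ Fintype.card α := by
  simp [avoidFactor]

theorem coeff_avoidFactor_mul (c : α → ZMod p) (v : V) (F : AddMonoidAlgebra R V) (u : V)
    (h : ∀ m, 1 ≤ m → m ≤ Fintype.card α → F.coeff (u - m • v) = 0) :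
    (avoidFactor ψ c v * F).coeff u = F.coeff u :=
  coeff_prod_one_sub_single_mul univ _ v F u h

theorem exists_coeff_ne_zero_of_coeff_avoidFactor_mul_ne_zero {c : α → ZMod p} {v : V}
    {F : AddMonoidAlgebra R V} {u : V} (h : (avoidFactor ψ c v * F).coeff u ≠ 0) :
    ∃ m ≤ Fintype.card α, F.coeff (u - m • v) ≠ 0 := by
  by_contra! hF
  rw [coeff_avoidFactor_mul ψ c v F u fun m _ hm => hF m hm] at h
  exact h (by simpa using hF 0 (Nat.zero_le _))

theorem mem_boxSum_of_coeff_prod_avoidFactor_ne_zero (c : ι → α → ZMod p)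
    (v : ι → V) (s : Finset ι) {u : V} (h : (∏ i ∈ s, avoidFactor ψ (c i) (v i)).coeff u ≠ 0) :
    u ∈ boxSum (fun _ => Set.Iic (Fintype.card α)) v s := by
  classical
  induction s using Finset.induction_on generalizing u with
  | empty =>
    rw [boxSum_empty]
    by_contra hu
    exact h (by rw [prod_empty, one_def, coeff_single, Finsupp.single_eq_of_ne hu])
  | insert j s hj ih =>
    rw [prod_insert hj] at h
    obtain ⟨m, hm, hcoeff⟩ := exists_coeff_ne_zero_of_coeff_avoidFactor_mul_ne_zero ψ h
    have := smul_add_mem_boxSum_insert hj (A := fun _ => Set.Iic (Fintype.card α)) hm (ih hcoeff)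
    rwa [add_sub_cancel] at this

theorem exists_sub_nsmul_mem_boxSum {c : ι → α → ZMod p} {v : ι → V} {s : Finset ι}
    {c' : α → ZMod p} {v' : V} (hs : ∏ i ∈ s, avoidFactor ψ (c i) (v i) ≠ 0)
    (hmul : avoidFactor ψ c' v' * ∏ i ∈ s, avoidFactor ψ (c i) (v i) = 0) :
    ∃ m, 1 ≤ m ∧ m ≤ Fintype.card α ∧ ∃ u ∈ boxSum (fun _ => Set.Iic (Fintype.card α)) v s,
      u - m • v' ∈ boxSum (fun _ => Set.Iic (Fintype.card α)) v s := by
  obtain ⟨u, hu⟩ : ∃ u, (∏ i ∈ s, avoidFactor ψ (c i) (v i)).coeff u ≠ 0 := by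
    by_contra! h
    exact hs (by ext u; simpa using h u)
  obtain ⟨m, hm₁, hm, hcoeff⟩ : ∃ m, 1 ≤ m ∧ m ≤ Fintype.card α ∧
      (∏ i ∈ s, avoidFactor ψ (c i) (v i)).coeff (u - m • v') ≠ 0 := by
    by_contra! h
    refine hu ?_
    rw [← coeff_avoidFactor_mul ψ c' v' _ u h, hmul, coeff_zero, Finsupp.zero_apply]
  exact ⟨m, hm₁, hm, u, mem_boxSum_of_coeff_prod_avoidFactor_ne_zero ψ c v s hu,
    mem_boxSum_of_coeff_prod_avoidFactor_ne_zero ψ c v s hcoeff⟩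

theorem prod_avoidFactor_ne_zero [Fact p.Prime] [Module (ZMod p) V] [Nontrivial R]
    (hα : Fintype.card α < p) (c : ι → α → ZMod p) {v : ι → V}
    (hv : LinearIndependent (ZMod p) v) (s : Finset ι) :
    ∏ i ∈ s, avoidFactor ψ (c i) (v i) ≠ 0 := by
  classical
  suffices h : (∏ i ∈ s, avoidFactor ψ (c i) (v i)).coeff 0 = 1 by
    intro h0
    simp [h0] at h
  induction s using Finset.induction_on with
  | empty => simp [one_def]
  | insert j s hj ih =>
    rw [prod_insert hj, coeff_avoidFactor_mul ψ _ _ _ _ fun m hm1 hm => ?_, ih]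
    by_contra hcoeff
    have hmem := boxSum_subset_span (R := ZMod p) _ _ _
      (mem_boxSum_of_coeff_prod_avoidFactor_ne_zero ψ c v s hcoeff)
    rw [zero_sub, SetLike.mem_coe, neg_mem_iff, ← Nat.cast_smul_eq_nsmul (ZMod p)] at hmem
    have hm0 : (m : ZMod p) ≠ 0 := fun h =>
      (Nat.le_of_dvd hm1 ((ZMod.natCast_eq_zero_iff m p).mp h)).not_gt (hm.trans_lt hα)
    exact hv.notMem_span_image (mod_cast hj) ((Submodule.smul_mem_iff _ hm0).mp hmem)

theorem avoidFactor_dvd_smul [NeZero p] [Module (ZMod p) V] (c : α → ZMod p) (v : V)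
    (d : ZMod p) : avoidFactor ψ c v ∣ avoidFactor ψ (d • c) (d • v) := by
  refine prod_dvd_prod_of_dvd _ _ fun l _ => ?_
  obtain ⟨m, rfl⟩ := ZMod.natCast_zmod_surjective d
  have h : single ((m : ZMod p) • v) (ψ (-((m : ZMod p) • c) l)) = single v (ψ (-c l)) ^ m := by
    rw [single_pow, ← AddChar.map_nsmul_eq_pow, Nat.cast_smul_eq_nsmul, Nat.cast_smul_eq_nsmul,
      Pi.smul_apply, smul_neg]
  rw [h]
  exact one_sub_dvd_one_sub_pow _ m

theorem avoidFactor_smul_dvd [Fact p.Prime] [Module (ZMod p) V] (c : α → ZMod p) (v : V)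
    {d : ZMod p} (hd : d ≠ 0) : avoidFactor ψ (d • c) (d • v) ∣ avoidFactor ψ c v := by
  simpa only [inv_smul_smul₀ hd] using avoidFactor_dvd_smul ψ (d • c) (d • v) d⁻¹

end AvoidFactor

section Translation

variable {R V ι α : Type*} [CommRing R] [AddCommGroup V] {p : ℕ} [Fact p.Prime]
  [Module (ZMod p) V] [Fintype α] (ψ : AddChar (ZMod p) R)

-- Rescaling a vector by a nonzero scalar changes its factor only up to mutual divisibility.
theorem exists_nsmul_eq_sum_zsmul_smul {c : ι → α → ZMod p} {v : ι → V} {s : Finset ι}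
    {c' : α → ZMod p} {v' : V} (hs : ∏ i ∈ s, avoidFactor ψ (c i) (v i) ≠ 0)
    (hmul : avoidFactor ψ c' v' * ∏ i ∈ s, avoidFactor ψ (c i) (v i) = 0)
    {δ : ι → ZMod p} (hδ : ∀ i ∈ s, δ i ≠ 0) (d : ZMod p) :
    ∃ m : ℕ, 1 ≤ m ∧ m ≤ Fintype.card α ∧ ∃ e : ι → ℤ, (∀ i ∈ s, |e i| ≤ Fintype.card α) ∧
      m • d • v' = ∑ i ∈ s, e i • δ i • v i := by
  have hdvd : ∏ i ∈ s, avoidFactor ψ (δ i • c i) (δ i • v i) ∣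
      ∏ i ∈ s, avoidFactor ψ (c i) (v i) :=
    prod_dvd_prod_of_dvd _ _ fun i hi => avoidFactor_smul_dvd ψ _ _ (hδ i hi)
  have hdvd' : avoidFactor ψ c' v' * ∏ i ∈ s, avoidFactor ψ (c i) (v i) ∣
      avoidFactor ψ (d • c') (d • v') * ∏ i ∈ s, avoidFactor ψ (δ i • c i) (δ i • v i) :=
    mul_dvd_mul (avoidFactor_dvd_smul ψ _ _ _)
      (prod_dvd_prod_of_dvd _ _ fun i _ => avoidFactor_dvd_smul ψ _ _ _)
  obtain ⟨m, hm₁, hm, u, ⟨z, hz, rfl⟩, z', hz', hu⟩ :=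
    exists_sub_nsmul_mem_boxSum ψ (c := fun i => δ i • c i) (v := fun i => δ i • v i)
      (ne_zero_of_dvd_ne_zero hs hdvd) (zero_dvd_iff.mp (hmul ▸ hdvd'))
  refine ⟨m, hm₁, hm, fun i => z i - z' i, fun i hi => ?_, ?_⟩
  · have := hz i hi
    have := hz' i hi
    simp only [Set.mem_Iic] at *
    rw [abs_le]
    lia
  · simp only [sub_smul, sum_sub_distrib, natCast_zsmul, hu, sub_sub_cancel]

variable {A : ι → Finset (ZMod p)} {v : ι → V} {c : ι → α → ZMod p}

theorem smul_add_mem_boxSum_insert_of_prod_eq_zero [DecidableEq ι] {s : Finset ι} {j : ι}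
    (hj : j ∉ s) (hs : ∏ i ∈ s, avoidFactor ψ (c i) (v i) ≠ 0)
    (hjs : ∏ i ∈ insert j s, avoidFactor ψ (c i) (v i) = 0)
    (hS : ∀ i, IsSType (Fintype.card α) (A i)) (hN : IsNType (Fintype.card α) (A j))
    (x : ZMod p) {y : V} (hy : y ∈ boxSum (fun i => (A i : Set (ZMod p))) v s) :
    x • v j + y ∈ boxSum (fun i => (A i : Set (ZMod p))) v (insert j s) := by
  by_cases hx : x ∈ A j
  · exact smul_add_mem_boxSum_insert hj hx hy
  obtain ⟨z, hz, rfl⟩ := hy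
  obtain ⟨d, -, hd⟩ := hN.2 x hx
  have hprog : ∀ i, ∃ δ : ZMod p, δ ≠ 0 ∧ (i ∈ s → ∀ e : ℤ, |e| ≤ Fintype.card α →
      z i - e * δ ∈ A i) := by
    intro i
    by_cases hi : i ∈ s
    · obtain ⟨δ, hδ, h⟩ := hS i (z i) (hz i hi)
      refine ⟨δ, hδ, fun _ e he => ?_⟩
      have := h (-e) (neg_le_neg (abs_le.mp he).2) (neg_le.mp (abs_le.mp he).1)
      rwa [Int.cast_neg, neg_mul, ← sub_eq_add_neg] at this
    · exact ⟨1, one_ne_zero, fun h => absurd h hi⟩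
  choose δ hδ hA using hprog
  rw [prod_insert hj] at hjs
  obtain ⟨m, hm₁, hm, e, he, heq⟩ := exists_nsmul_eq_sum_zsmul_smul ψ hs hjs (fun i _ => hδ i) d
  have hbox := smul_add_mem_boxSum_insert hj (hd m (mod_cast hm₁) (mod_cast hm))
    (A := fun i => (A i : Set (ZMod p))) (v := v)
    ⟨fun i => z i - e i * δ i, fun i hi => hA i hi (e i) (he i hi), rfl⟩
  convert hbox using 1
  simp only [sub_smul, sum_sub_distrib, mul_smul, Int.cast_smul_eq_zsmul, ← heq, add_smul,
    Int.cast_natCast, Nat.cast_smul_eq_nsmul]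
  abel

theorem exists_add_mem_boxSum_of_prod_eq_zero [DecidableEq ι] {T U : Finset ι} (hTU : T ⊆ U)
    (hT : ∏ i ∈ T, avoidFactor ψ (c i) (v i) ≠ 0) (hU : ∏ i ∈ U, avoidFactor ψ (c i) (v i) = 0)
    (hS : ∀ i, IsSType (Fintype.card α) (A i)) (hN : ∀ i ∉ T, IsNType (Fintype.card α) (A i)) :
    ∃ s, T ⊂ s ∧ ∀ u ∈ Submodule.span (ZMod p) (v '' ↑(s \ T)),
      ∀ x ∈ boxSum (fun i => (A i : Set (ZMod p))) v s,
        u + x ∈ boxSum (fun i => (A i : Set (ZMod p))) v s := by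
  obtain ⟨s, -, ⟨hTs, hs0⟩, hmin⟩ := exists_minimal_le_of_wellFoundedLT
    (fun s => T ⊆ s ∧ ∏ i ∈ s, avoidFactor ψ (c i) (v i) = 0) U ⟨hTU, hU⟩
  refine ⟨s, hTs.ssubset_of_ne (by rintro rfl; exact hT hs0), fun u hu => ?_⟩
  induction hu using Submodule.closure_induction with
  | zero => simp
  | add u w _ _ hu hw => exact fun x hx => by rw [add_assoc]; exact hu _ (hw x hx)
  | smul_mem a u hu =>
    obtain ⟨j, hj, rfl⟩ := hu
    obtain ⟨hjs, hjT⟩ := mem_sdiff.mp hj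
    have hne : ∏ i ∈ s.erase j, avoidFactor ψ (c i) (v i) ≠ 0 := fun h0 =>
      notMem_erase j s (hmin ⟨subset_erase.mpr ⟨hTs, hjT⟩, h0⟩ (erase_subset j s) hjs)
    intro x hx
    rw [← insert_erase hjs] at hx hs0 ⊢
    obtain ⟨b, -, y, hy, rfl⟩ := exists_smul_add_of_mem_boxSum_insert (notMem_erase j s) hx
    rw [← add_assoc, ← add_smul]
    exact smul_add_mem_boxSum_insert_of_prod_eq_zero ψ (notMem_erase j s) hne hs0 hS (hN j hjT) _ hy

end Translation

section Counting

variable {K V ι κ : Type*} [Field K] [AddCommGroup V] [Module K V]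

theorem exists_finset_card_le_finrank_forall_eq_zero (T : Submodule K (κ → K))
    [FiniteDimensional K T] :
    ∃ s : Finset κ, #s ≤ finrank K T ∧ ∀ x ∈ T, (∀ i ∈ s, x i = 0) → x = 0 := by
  let f : κ → Dual K T := fun i => LinearMap.proj i ∘ₗ T.subtype
  obtain ⟨s, -, -, hspan, hli⟩ :=
    exists_linearIndepOn_extension (linearIndepOn_empty K f) (Set.subset_univ ∅)
  have : Finite s := LinearIndependent.finite hli
  have : Fintype s := Fintype.ofFinite s
  refine ⟨s.toFinset, ?_, fun x hx hxs => funext fun i => ?_⟩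
  · rw [Set.toFinset_card, ← Subspace.dual_finrank_eq]
    exact LinearIndependent.fintype_card_le_finrank hli
  · have hker : Submodule.span K (f '' s) ≤ LinearMap.ker (Dual.eval K T ⟨x, hx⟩) := by
      rw [Submodule.span_le]
      rintro _ ⟨j, hj, rfl⟩
      exact hxs j (Set.mem_toFinset.mpr hj)
    exact hker (hspan ⟨i, trivial, rfl⟩)

theorem card_le_pow_finrank_of_sub_mem {B : Finset K} (hB : B.Nonempty)
    (T : Submodule K (κ → K)) [FiniteDimensional K T] {Y : Finset (κ → K)}
    (hYB : ∀ y ∈ Y, ∀ i, y i ∈ B) (hYT : ∀ y ∈ Y, ∀ y' ∈ Y, y - y' ∈ T) :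
    #Y ≤ #B ^ finrank K T := by
  classical
  obtain ⟨s, hs, hT⟩ := exists_finset_card_le_finrank_forall_eq_zero T
  calc #Y ≤ #(Fintype.piFinset fun _ : s => B) :=
        card_le_card_of_injOn (fun y i => y i)
          (fun y hy => Fintype.mem_piFinset.mpr fun i => hYB y hy i)
          fun y hy y' hy' h => sub_eq_zero.mp <| hT _ (hYT y hy y' hy') fun i hi =>
            sub_eq_zero.mpr (congrFun h ⟨i, hi⟩)
    _ = #B ^ #s := by simp
    _ ≤ #B ^ finrank K T := Nat.pow_le_pow_right hB.card_pos hs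

theorem finrank_comap_le_of_injective {W : Type*} [AddCommGroup W] [Module K W] {f : W →ₗ[K] V}
    (hf : Function.Injective f) (U : Submodule K V) [FiniteDimensional K U] :
    finrank K (U.comap f) ≤ finrank K U := by
  rw [(Submodule.equivMapOfInjective f hf (U.comap f)).finrank_eq]
  exact Submodule.finrank_mono (Submodule.map_comap_le f U)

theorem natCard_le_of_forall_add_mem [Fintype κ] {w : κ → V} (hw : LinearIndependent K w)
    {B : Finset K} (hB : B.Nonempty) (U : Submodule K V) [FiniteDimensional K U] {Z X : Set V}
    (hZ : Z.Finite) (hZU : Z ⊆ U) (hX : X.Nonempty) (hUX : ∀ u ∈ U, ∀ x ∈ X, u + x ∈ X)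
    (hXZ : ∀ x ∈ X, ∃ z ∈ Z, ∃ y ∈ boxSum (fun _ => (B : Set K)) w univ, z + y = x) :
    Nat.card U ≤ Z.ncard * #B ^ finrank K U := by
  classical
  obtain ⟨x, hx⟩ := hX
  let f := Fintype.linearCombination K w
  let Y : Finset (κ → K) := {y ∈ Fintype.piFinset fun _ => B | f y - x ∈ U}
  have hY : #Y ≤ #B ^ finrank K U := calc
    #Y ≤ #B ^ finrank K (U.comap f) :=
      card_le_pow_finrank_of_sub_mem hB _
        (fun y hy => Fintype.mem_piFinset.mp (mem_filter.mp hy).1) fun y hy y' hy' => by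
          have := U.sub_mem (mem_filter.mp hy).2 (mem_filter.mp hy').2
          rwa [sub_sub_sub_cancel_right, ← map_sub] at this
    _ ≤ #B ^ finrank K U := Nat.pow_le_pow_right hB.card_pos
      (finrank_comap_le_of_injective hw.fintypeLinearCombination_injective U)
  have hrep : ∀ u : U, ∃ a : Z × Y, (a.1 : V) + f a.2 = u + x := by
    intro u
    obtain ⟨z, hz, _, ⟨y, hy, rfl⟩, h⟩ := hXZ _ (hUX u u.2 x hx)
    have hyU : f y - x ∈ U := by
      have : f y - x = u - z := by rw [sub_eq_sub_iff_add_eq_add, ← h, add_comm]; rfl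
      exact this ▸ U.sub_mem u.2 (hZU hz)
    exact ⟨⟨⟨z, hz⟩, y, mem_filter.mpr
      ⟨Fintype.mem_piFinset.mpr fun i => hy i (mem_univ i), hyU⟩⟩, h⟩
  choose a ha using hrep
  have ha_inj : Function.Injective a := fun u u' h =>
    Subtype.ext (add_right_cancel ((ha u).symm.trans (h ▸ ha u')))
  have : Finite Z := hZ
  calc Nat.card U ≤ Nat.card (Z × Y) := Nat.card_le_card_of_injective a ha_inj
    _ = Z.ncard * #Y := by rw [Nat.card_prod, Nat.card_coe_set_eq, Nat.card_eq_finsetCard]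
    _ ≤ Z.ncard * #B ^ finrank K U := Nat.mul_le_mul_left _ hY

theorem card_le_card_mul_finrank_span {β : Type*} [Fintype β] {v : ι → V}
    (hv : LinearIndependent K v) (C : Finset (ι × β)) :
    #C ≤ Fintype.card β * finrank K (Submodule.span K ((fun x => v x.1) '' (C : Set (ι × β)))) := by
  classical
  have hrange : Set.range (v ∘ (Subtype.val : C.image Prod.fst → ι)) =
      (fun x => v x.1) '' (C : Set (ι × β)) := by
    rw [Set.range_comp, Subtype.range_coe, coe_image, Set.image_image]
  have hspan := finrank_span_eq_card
    (hv.comp (Subtype.val : C.image Prod.fst → ι) Subtype.val_injective)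
  rw [hrange, Fintype.card_coe] at hspan
  calc #C ≤ #(C.image Prod.fst ×ˢ (univ : Finset β)) :=
        card_le_card fun x hx => mem_product.mpr ⟨mem_image_of_mem _ hx, mem_univ _⟩
    _ = _ := by rw [card_product, hspan, mul_comm, card_univ]

open scoped Pointwise in
theorem natCard_span_le_of_forall_add_mem_boxSum {β : Type*} [Fintype κ] [Fintype β] {v : ι → V}
    {w : κ → V} (hv : LinearIndependent K v) (hw : LinearIndependent K w) {A B : Finset K}
    (hA : A.Nonempty) (hB : B.Nonempty) {C : Finset (ι × β)} {U : Submodule K V}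
    (hU : U = Submodule.span K ((fun x => v x.1) '' (C : Set (ι × β)))) {X : Set V}
    (hX : X = boxSum
      (fun i => ((Sum.elim (fun _ : ι × β => A) (fun _ : κ × β => B) i : Finset K) : Set K))
      (Sum.elim (fun x => v x.1) fun x => w x.1) (C.disjSum univ))
    (hUX : ∀ u ∈ U, ∀ x ∈ X, u + x ∈ X) :
    Nat.card U ≤ ((#A * #B) ^ Fintype.card β) ^ finrank K U := by
  classical
  have : FiniteDimensional K U := hU ▸ FiniteDimensional.span_of_finite K (C.finite_toSet.image _)
  let Z : Set V := boxSum (fun _ => (A : Set K)) (fun x : ι × β => v x.1) C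
  have hXne : X.Nonempty := hX ▸ boxSum_nonempty (by rintro (_ | _) <;> simpa) _ _
  have hXZ : ∀ x ∈ X, ∃ z ∈ Z, ∃ y ∈ boxSum (fun _ => ((Fintype.card β • B : Finset K) : Set K))
      w univ, z + y = x := by
    intro x hx
    obtain ⟨z, hz, y, hy, h⟩ := exists_add_of_mem_boxSum_disjSum (hX ▸ hx)
    exact ⟨z, hz, y, boxSum_comp_fst_subset B w hy, h⟩
  have hcard : #C ≤ Fintype.card β * finrank K U := hU ▸ card_le_card_mul_finrank_span hv C
  calc Nat.card U ≤ Z.ncard * #(Fintype.card β • B) ^ finrank K U :=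
        natCard_le_of_forall_add_mem hw hB.nsmul U (finite_boxSum A _ C)
          (hU ▸ boxSum_subset_span _ _ C) hXne hUX hXZ
    _ ≤ #A ^ (Fintype.card β * finrank K U) * (#B ^ Fintype.card β) ^ finrank K U :=
        Nat.mul_le_mul ((ncard_boxSum_le A _ C).trans (Nat.pow_le_pow_right hA.card_pos hcard))
          (Nat.pow_le_pow_left card_nsmul_le _)
    _ = ((#A * #B) ^ Fintype.card β) ^ finrank K U := by rw [pow_mul, ← mul_pow, ← mul_pow]

end Counting

section NonVanishing

variable {R V ι κ α β : Type*} [CommRing R] [Nontrivial R] [AddCommGroup V] {p : ℕ}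
  [Fact p.Prime] [Module (ZMod p) V] [Fintype ι] [Fintype κ] [Fintype α] [Fintype β]

theorem prod_prod_avoidFactor_ne_zero (ψ : AddChar (ZMod p) R)
    (hp : Fintype.card β * Fintype.card α < p) {w : κ → V} (hw : LinearIndependent (ZMod p) w)
    (d : κ → β → α → ZMod p) : ∏ x : κ × β, avoidFactor ψ (d x.1 x.2) (w x.1) ≠ 0 := by
  have h := prod_avoidFactor_ne_zero ψ (by rwa [Fintype.card_prod])
    (fun j (x : β × α) => d j x.1 x.2) hw univ
  simpa only [avoidFactor, Fintype.prod_prod_type] using h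

theorem prod_avoidFactor_mul_prod_avoidFactor_ne_zero (ψ : AddChar (ZMod p) R)
    (hp : Fintype.card β * Fintype.card α < p) {A B : Finset (ZMod p)} (hA : A.Nonempty)
    (hAN : IsNType (Fintype.card α) A) (hB : B.Nonempty) (hBS : IsSType (Fintype.card α) B)
    (hcard : (#A * #B) ^ Fintype.card β < p) {v : ι → V} (hv : LinearIndependent (ZMod p) v)
    {w : κ → V} (hw : LinearIndependent (ZMod p) w) (c : ι → β → α → ZMod p)
    (d : κ → β → α → ZMod p) :
    (∏ i, ∏ b, avoidFactor ψ (c i b) (v i)) * ∏ j, ∏ b, avoidFactor ψ (d j b) (w j) ≠ 0 := by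
  classical
  intro hzero
  let v' : (ι × β) ⊕ (κ × β) → V := Sum.elim (fun x => v x.1) fun x => w x.1
  let c' : (ι × β) ⊕ (κ × β) → α → ZMod p := Sum.elim (fun x => c x.1 x.2) fun x => d x.1 x.2
  let T : Finset ((ι × β) ⊕ (κ × β)) := disjSum ∅ univ
  obtain ⟨s, hTs, hs⟩ := exists_add_mem_boxSum_of_prod_eq_zero ψ (T := T) (U := univ) (v := v')
    (c := c') (A := Sum.elim (fun _ => A) fun _ => B) (subset_univ T)
    (by simpa [T, c', v', prod_disjSum] using prod_prod_avoidFactor_ne_zero ψ hp hw d)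
    (by simpa [c', v', Fintype.prod_sum_type, Fintype.prod_prod_type] using hzero)
    (by rintro (_ | _); exacts [hAN.1, hBS])
    (by rintro (_ | _) hi; exacts [hAN, absurd (by simp [T]) hi])
  have hs_right : s.toRight = univ :=
    eq_univ_iff_forall.mpr fun x => mem_toRight.mpr (hTs.1 (by simp [T]))
  obtain ⟨C, rfl⟩ : ∃ C : Finset (ι × β), s = C.disjSum univ :=
    ⟨s.toLeft, toLeft_disjSum_toRight.symm.trans (congrArg _ hs_right)⟩
  let U := Submodule.span (ZMod p) ((fun x => v x.1) '' (C : Set (ι × β)))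
  have hU : U ≤ Submodule.span (ZMod p) (v' '' ↑(C.disjSum univ \ T)) := by
    refine Submodule.span_mono ?_
    rintro _ ⟨x, hx, rfl⟩
    exact ⟨Sum.inl x, by simpa [T] using hx, rfl⟩
  have hle : Nat.card U ≤ ((#A * #B) ^ Fintype.card β) ^ finrank (ZMod p) U :=
    natCard_span_le_of_forall_add_mem_boxSum hv hw hA hB rfl rfl fun u hu => hs u (hU hu)
  have hfin : finrank (ZMod p) U ≠ 0 := fun h => by
    have hC : #C ≤ Fintype.card β * finrank (ZMod p) U := card_le_card_mul_finrank_span hv C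
    rw [h, mul_zero, Nat.le_zero, card_eq_zero] at hC
    exact hTs.ne (hC ▸ rfl)
  have : Module.Finite (ZMod p) U := finite_of_finrank_pos (Nat.pos_of_ne_zero hfin)
  rw [Module.natCard_eq_pow_finrank (K := ZMod p), Nat.card_zmod] at hle
  exact hle.not_gt (Nat.pow_lt_pow_left hcard hfin)

end NonVanishing

section Evaluation

variable {R V : Type*} [CommRing R] [AddCommGroup V] {p : ℕ} [Module (ZMod p) V]
  (ψ : AddChar (ZMod p) R)

/-- Evaluation of an element of the group ring at the character `v ↦ ψ (f v)`, where `f` is a linear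
functional: a Fourier coefficient of the element. -/
noncomputable def evalDual (f : Dual (ZMod p) V) : AddMonoidAlgebra R V →ₐ[R] R :=
  lift R R V (ψ.compAddMonoidHom f.toAddMonoidHom).toMonoidHom

theorem evalDual_single (f : Dual (ZMod p) V) (v : V) (a : R) :
    evalDual ψ f (single v a) = a * ψ (f v) :=
  lift_single _ v a

theorem apply_ne_of_evalDual_avoidFactor_ne_zero {α : Type*} [Fintype α] {f : Dual (ZMod p) V}
    {c : α → ZMod p} {v : V} (h : evalDual ψ f (avoidFactor ψ c v) ≠ 0) (l : α) : f v ≠ c l := by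
  intro hl
  refine h ?_
  rw [avoidFactor, map_prod]
  refine prod_eq_zero (mem_univ l) ?_
  rw [map_sub, map_one, evalDual_single, ← AddChar.map_add_eq_mul, hl, neg_add_cancel,
    AddChar.map_zero_eq_one, sub_self]

theorem exists_evalDual_ne_zero [Fact p.Prime] [IsDomain R] (hψ : Function.Injective ψ)
    {F : AddMonoidAlgebra R V} (hF : F ≠ 0) : ∃ f, evalDual ψ f F ≠ 0 := by
  by_contra! h
  let χ : V → Multiplicative (Dual (ZMod p) V) →* R := fun v =>
    (ψ.compAddMonoidHom (Dual.eval (ZMod p) V v).toAddMonoidHom).toMonoidHom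
  have hχ : Function.Injective χ := fun v w hvw =>
    eval_apply_injective (ZMod p) <| LinearMap.ext fun f =>
      hψ (DFunLike.congr_fun hvw (Multiplicative.ofAdd f))
  have hli := linearIndependent_iff.mp ((linearIndependent_monoidHom _ R).comp χ hχ)
  refine hF (coeff_eq_zero.mp (hli F.coeff (funext fun f => ?_)))
  rw [Finsupp.linearCombination_apply, Finsupp.sum, Finset.sum_apply]
  exact (lift_apply _ F).symm.trans (h f.toAdd)

end Evaluation

section BalancedSets

open scoped Pointwise

variable {p : ℕ}

theorem IsSType.isNType_one {A : Finset (ZMod p)} (h : IsSType 1 A) (hA : A.Nonempty) :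
    IsNType 1 A := by
  refine ⟨h, fun a ha => ?_⟩
  obtain ⟨b, hb⟩ := hA
  refine ⟨b - a, sub_ne_zero.mpr (by rintro rfl; exact ha hb), fun i h1 h2 => ?_⟩
  obtain rfl : i = 1 := le_antisymm (by simpa using h2) h1
  simpa using hb

theorem isSType_one_of_forall_exists {A : Finset (ZMod p)}
    (h : ∀ a ∈ A, ∃ b ∈ A, b ≠ a ∧ 2 * a - b ∈ A) : IsSType 1 A := by
  intro a ha
  obtain ⟨b, hb, hne, hc⟩ := h a ha
  refine ⟨b - a, sub_ne_zero.mpr hne, fun i h1 h2 => ?_⟩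
  obtain rfl | rfl | rfl : i = -1 ∨ i = 0 ∨ i = 1 := by push_cast at h1 h2; lia
  · convert hc using 1
    push_cast
    ring
  · simpa using ha
  · simpa using hb

/-- The set of residues `0` and `±⌊p / 2 ^ j⌋` for `1 ≤ j ≤ log₂ p`, an `S_1`-type set of
logarithmic size: `⌊p / 2 ^ j⌋` is the midpoint of `⌊p / 2 ^ (j - 1)⌋` and `0` or `-1`. -/
def halvingSet (p : ℕ) : Finset (ZMod p) :=
  let X := (Icc 1 (Nat.log 2 p)).image fun j => ((p / 2 ^ j : ℕ) : ZMod p)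
  insert 0 (X ∪ -X)

theorem zero_mem_halvingSet : 0 ∈ halvingSet p :=
  mem_insert_self _ _

theorem halvingSet_nonempty : (halvingSet p).Nonempty :=
  ⟨0, zero_mem_halvingSet⟩

theorem card_halvingSet_le : #(halvingSet p) ≤ 2 * Nat.log 2 p + 1 := by
  have hX : #((Icc 1 (Nat.log 2 p)).image fun j => ((p / 2 ^ j : ℕ) : ZMod p)) ≤ Nat.log 2 p :=
    card_image_le.trans (by simp)
  refine (card_insert_le _ _).trans (Nat.add_le_add_right ((card_union_le _ _).trans ?_) 1)
  rw [card_neg]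
  lia

theorem neg_mem_halvingSet {a : ZMod p} (ha : a ∈ halvingSet p) : -a ∈ halvingSet p := by
  simp only [halvingSet, mem_insert, mem_union, mem_neg', neg_neg, neg_eq_zero] at ha ⊢
  tauto

theorem natCast_div_two_pow_mem_halvingSet (j : ℕ) : ((p / 2 ^ j : ℕ) : ZMod p) ∈ halvingSet p := by
  rcases Nat.eq_zero_or_pos j with rfl | hj
  · simpa using zero_mem_halvingSet
  rcases le_or_gt j (Nat.log 2 p) with hjp | hjp
  · exact mem_insert_of_mem (mem_union_left _ (mem_image_of_mem _ (mem_Icc.mpr ⟨hj, hjp⟩)))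
  · rw [Nat.div_eq_of_lt (Nat.lt_pow_of_log_lt one_lt_two hjp), Nat.cast_zero]
    exact zero_mem_halvingSet

theorem one_mem_halvingSet (hp : p ≠ 0) : 1 ∈ halvingSet p := by
  have h : p / 2 ^ Nat.log 2 p = 1 := Nat.div_eq_of_lt_le
    (by simpa using Nat.pow_log_le_self 2 hp)
    (by simpa [pow_succ'] using Nat.lt_pow_succ_log_self one_lt_two p)
  simpa [h] using natCast_div_two_pow_mem_halvingSet (p := p) (Nat.log 2 p)

theorem exists_mem_halvingSet_of_natCast_div {j : ℕ} (hj : j ∈ Icc 1 (Nat.log 2 p)) :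
    ∃ b ∈ halvingSet p, b ≠ ((p / 2 ^ j : ℕ) : ZMod p) ∧
      2 * ((p / 2 ^ j : ℕ) : ZMod p) - b ∈ halvingSet p := by
  obtain ⟨hj₁, hjp⟩ := mem_Icc.mp hj
  obtain ⟨i, rfl⟩ := Nat.exists_eq_add_of_le' hj₁
  have hp : p ≠ 0 := by rintro rfl; simp at hjp
  refine ⟨_, natCast_div_two_pow_mem_halvingSet i, ?_⟩
  have hle : p / 2 ^ i ≤ p := Nat.div_le_self _ _
  have hpos : 0 < p / 2 ^ (i + 1) := Nat.div_pos (Nat.pow_le_of_le_log hp hjp) (by positivity)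
  have hhalf : p / 2 ^ i = 2 * (p / 2 ^ (i + 1)) + p / 2 ^ i % 2 := by
    rw [pow_succ, ← Nat.div_div_eq_div_mul, Nat.div_add_mod]
  generalize p / 2 ^ (i + 1) = m at *
  generalize p / 2 ^ i = l at *
  constructor
  · intro h
    have hdvd : p ∣ l - m :=
      (Nat.modEq_iff_dvd' (by lia)).mp ((ZMod.natCast_eq_natCast_iff _ _ _).mp h.symm)
    exact absurd (Nat.le_of_dvd (by lia) hdvd) (by lia)
  · rcases Nat.mod_two_eq_zero_or_one l with h | h <;> rw [hhalf, h]
    · simpa using zero_mem_halvingSet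
    · simpa using neg_mem_halvingSet (one_mem_halvingSet hp)

theorem isSType_one_halvingSet (hp : 1 < p) : IsSType 1 (halvingSet p) := by
  have : Fact (1 < p) := ⟨hp⟩
  have h1 : 1 ∈ halvingSet p := one_mem_halvingSet (by lia)
  refine isSType_one_of_forall_exists fun a ha => ?_
  rw [halvingSet, mem_insert, mem_union, mem_neg', mem_image, mem_image] at ha
  obtain rfl | ⟨j, hj, rfl⟩ | ⟨j, hj, ha⟩ := ha
  · exact ⟨1, h1, one_ne_zero, by simpa using neg_mem_halvingSet h1⟩
  · exact exists_mem_halvingSet_of_natCast_div hj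
  · obtain ⟨b, hb, hne, hc⟩ := exists_mem_halvingSet_of_natCast_div hj
    rw [ha] at hne hc
    refine ⟨-b, neg_mem_halvingSet hb, fun h => hne (neg_eq_iff_eq_neg.mp h), ?_⟩
    convert neg_mem_halvingSet hc using 1
    ring

theorem exists_isSType_one_of_list {l : List ℕ} (hl : l ≠ []) (hlt : ∀ a ∈ l, a < p)
    (h : ∀ a ∈ l, ∃ b ∈ l, b ≠ a ∧ ∃ c ∈ l, (b + c) % p = 2 * a % p) :
    ∃ A : Finset (ZMod p), A.Nonempty ∧ IsSType 1 A ∧ #A ≤ l.length := by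
  refine ⟨(l.map Nat.cast).toFinset, by simpa using hl, isSType_one_of_forall_exists ?_,
    by simpa using List.toFinset_card_le (l.map (Nat.cast : ℕ → ZMod p))⟩
  simp only [List.mem_toFinset, List.mem_map, forall_exists_index, and_imp,
    forall_apply_eq_imp_iff₂]
  intro a ha
  obtain ⟨b, hb, hne, c, hc, hbc⟩ := h a ha
  refine ⟨b, ⟨b, hb, rfl⟩, fun hba => hne ?_, c, hc, ?_⟩
  · exact ((ZMod.natCast_eq_natCast_iff _ _ _).mp hba).eq_of_lt_of_lt (hlt b hb) (hlt a ha)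
  · have hcast := (ZMod.natCast_eq_natCast_iff (b + c) (2 * a) p).mpr hbc
    push_cast at hcast
    exact eq_sub_of_add_eq' hcast

/-- `S_1`-type sets of fewer than `√p` residues, for the primes `61 < p ≠ 79` at which the bound
`2 log₂ p + 1` on the size of `halvingSet p` exceeds `√p`. -/
def balancedTable : List (ℕ × List ℕ) :=
  [(67, [0, 1, 3, 16, 31, 57, 62, 66]),
   (71, [0, 1, 3, 17, 33, 44, 66, 70]),
   (73, [0, 1, 3, 11, 21, 42, 68, 72]),
   (83, [0, 1, 2, 6, 13, 43, 66, 81, 82]),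
   (89, [0, 1, 2, 7, 39, 64, 76, 86, 88]),
   (97, [0, 1, 2, 7, 42, 69, 84, 94, 96]),
   (101, [0, 1, 2, 8, 15, 31, 62, 97, 100]),
   (103, [0, 1, 2, 8, 16, 56, 79, 99, 102]),
   (107, [0, 1, 2, 7, 27, 54, 94, 104, 106]),
   (109, [0, 1, 2, 8, 47, 78, 93, 105, 108]),
   (113, [0, 1, 2, 8, 48, 81, 97, 109, 112]),
   (127, [0, 1, 2, 8, 32, 63, 111, 123, 126]),
   (131, [0, 1, 3, 11, 22, 44, 77, 126, 130]),
   (137, [0, 1, 3, 11, 53, 74, 106, 132, 136]),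
   (139, [0, 1, 3, 11, 22, 43, 86, 134, 138]),
   (149, [0, 1, 3, 11, 64, 107, 128, 144, 148]),
   (151, [0, 1, 3, 11, 65, 108, 130, 146, 150]),
   (157, [0, 1, 2, 6, 13, 43, 80, 140, 155, 156]),
   (163, [0, 1, 2, 7, 27, 55, 110, 150, 160, 162]),
   (167, [0, 1, 2, 7, 39, 78, 142, 154, 164, 166]),
   (173, [0, 1, 2, 5, 21, 85, 130, 162, 170, 172]),
   (179, [0, 1, 2, 7, 69, 124, 151, 166, 176, 178]),
   (181, [0, 1, 2, 7, 70, 125, 153, 168, 178, 180]),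
   (191, [0, 1, 2, 7, 27, 55, 110, 178, 188, 190]),
   (193, [0, 1, 2, 7, 15, 51, 100, 172, 190, 192]),
   (197, [0, 1, 2, 8, 15, 53, 98, 174, 193, 196]),
   (199, [0, 1, 2, 8, 16, 88, 143, 175, 195, 198]),
   (211, [0, 1, 2, 8, 81, 146, 178, 195, 207, 210]),
   (223, [0, 1, 2, 8, 32, 64, 127, 207, 219, 222]),
   (257, [0, 1, 2, 8, 32, 128, 193, 241, 253, 256]),
   (263, [0, 1, 3, 11, 53, 137, 200, 232, 258, 262]),
   (269, [0, 1, 3, 11, 22, 119, 194, 237, 264, 268]),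
   (271, [0, 1, 3, 19, 38, 46, 73, 145, 231, 270]),
   (277, [0, 1, 3, 11, 107, 192, 235, 256, 272, 276]),
   (281, [0, 1, 3, 11, 65, 130, 238, 260, 276, 280]),
   (283, [0, 1, 2, 6, 22, 45, 88, 175, 273, 281, 282])]

theorem balancedTable_spec : ∀ e ∈ balancedTable, e.2 ≠ [] ∧ (∀ a ∈ e.2, a < e.1) ∧
    (∀ a ∈ e.2, ∃ b ∈ e.2, b ≠ a ∧ ∃ c ∈ e.2, (b + c) % e.1 = 2 * a % e.1) ∧
    e.2.length * e.2.length < e.1 := by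
  decide +kernel

theorem two_mul_add_one_sq_lt_two_pow {L : ℕ} (hL : 9 ≤ L) :
    (2 * L + 1) * (2 * L + 1) < 2 ^ L := by
  induction L, hL using Nat.le_induction with
  | base => norm_num
  | succ L hL ih =>
    rw [pow_succ]
    nlinarith

theorem exists_mem_balancedTable (hp : p.Prime) (h61 : 61 < p) (h79 : p ≠ 79)
    (hlog : p ≤ (2 * Nat.log 2 p + 1) * (2 * Nat.log 2 p + 1)) :
    ∃ l, (p, l) ∈ balancedTable := by
  have hlog_le : Nat.log 2 p ≤ 8 := by
    by_contra! h
    exact (hlog.trans_lt (two_mul_add_one_sq_lt_two_pow h)).not_ge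
      (Nat.pow_log_le_self 2 hp.ne_zero)
  have h17 : 2 * Nat.log 2 p + 1 ≤ 17 := by lia
  have hp_lt : p < 290 := Nat.lt_succ_of_le (hlog.trans (Nat.mul_le_mul h17 h17))
  have hcop : p.Coprime (Nat.factorial 17) :=
    hp.coprime_iff_not_dvd.mpr (mt hp.dvd_factorial.mp (by lia))
  have h : ∀ q < 290, 61 < q ∧ q ≠ 79 ∧ q.Coprime (Nat.factorial 17) ∧
      q ≤ (2 * Nat.log 2 q + 1) * (2 * Nat.log 2 q + 1) → q ∈ balancedTable.map Prod.fst := by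
    decide +kernel
  simpa using h p hp_lt ⟨h61, h79, hcop, hlog⟩

theorem exists_isSType_one_card_mul_card_lt (hp : p.Prime) (h61 : 61 < p) (h79 : p ≠ 79) :
    ∃ A : Finset (ZMod p), A.Nonempty ∧ IsSType 1 A ∧ #A * #A < p := by
  rcases lt_or_ge ((2 * Nat.log 2 p + 1) * (2 * Nat.log 2 p + 1)) p with hlog | hlog
  · exact ⟨halvingSet p, halvingSet_nonempty, isSType_one_halvingSet hp.one_lt,
      (Nat.mul_le_mul card_halvingSet_le card_halvingSet_le).trans_lt hlog⟩
  · obtain ⟨l, hl⟩ := exists_mem_balancedTable hp h61 h79 hlog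
    obtain ⟨hne, hlt, hmid, hlen⟩ := balancedTable_spec _ hl
    obtain ⟨A, hA, hS, hcard⟩ := exists_isSType_one_of_list hne hlt hmid
    exact ⟨A, hA, hS, (Nat.mul_le_mul hcard hcard).trans_lt hlen⟩

theorem two_mul_log_add_one_lt_two_pow {k p : ℕ} (hk : 2 ≤ k) (hp : k ^ (20 * k) ≤ p) :
    2 * Nat.log 2 p + 1 < 2 ^ (Nat.log 2 p / (2 * k)) := by
  set a := Nat.log 2 k
  set L := Nat.log 2 p
  set q := L / (2 * k)
  have hka : k < 2 ^ (a + 1) := Nat.lt_pow_succ_log_self one_lt_two k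
  have hLq : L < 2 * k * (q + 1) := Nat.lt_mul_div_succ L (by lia)
  have ha : 1 ≤ a := Nat.log_pos one_lt_two hk
  have haq : 10 * a ≤ q := by
    have hpow : 2 ^ (a * (20 * k)) ≤ p := by
      rw [pow_mul]
      exact (Nat.pow_le_pow_left (Nat.pow_log_le_self 2 (by lia)) _).trans hp
    rw [Nat.le_div_iff_mul_le (by lia)]
    calc 10 * a * (2 * k) = a * (20 * k) := by ring
      _ ≤ L := Nat.le_log_of_pow_le one_lt_two hpow
  calc 2 * L + 1 < k * (4 * (q + 1)) := by linarith
    _ ≤ 2 ^ (a + 1) * (4 * (2 * 2 ^ (q / 2))) := by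
      have := Nat.lt_two_pow_self (n := q / 2)
      exact Nat.mul_le_mul hka.le (by lia)
    _ = 2 ^ (a + 4 + q / 2) := by ring
    _ ≤ 2 ^ q := Nat.pow_le_pow_right two_pos (by lia)

theorem card_halvingSet_mul_self_pow_lt {k : ℕ} (hk : 2 ≤ k) (hp : k ^ (20 * k) ≤ p) :
    (#(halvingSet p) * #(halvingSet p)) ^ k < p := by
  have hp0 : p ≠ 0 := (Nat.pow_pos (by lia) |>.trans_le hp).ne'
  calc (#(halvingSet p) * #(halvingSet p)) ^ k = #(halvingSet p) ^ (2 * k) := by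
        rw [← sq, ← pow_mul]
    _ < (2 ^ (Nat.log 2 p / (2 * k))) ^ (2 * k) := Nat.pow_lt_pow_left
        (card_halvingSet_le.trans_lt (two_mul_log_add_one_lt_two_pow hk hp)) (by lia)
    _ = 2 ^ (Nat.log 2 p / (2 * k) * (2 * k)) := (pow_mul _ _ _).symm
    _ ≤ 2 ^ Nat.log 2 p := Nat.pow_le_pow_right two_pos (Nat.div_mul_le_self _ _)
    _ ≤ p := Nat.pow_log_le_self 2 hp0

end BalancedSets

section Avoidance

variable {V ι κ : Type*} [AddCommGroup V] {p : ℕ} [Fact p.Prime] [Module (ZMod p) V]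
  {v : ι → V} {w : κ → V}

theorem isNType_univ (k : ℕ) : IsNType k (univ : Finset (ZMod p)) :=
  ⟨fun _ _ => ⟨1, one_ne_zero, fun _ _ _ => mem_univ _⟩,
    fun _ _ => ⟨1, one_ne_zero, fun _ _ _ => mem_univ _⟩⟩

theorem exists_isNType_card_eq_N (k : ℕ) :
    ∃ A : Finset (ZMod p), A.Nonempty ∧ IsNType k A ∧ #A = N k p :=
  Nat.sInf_mem (s := {m | ∃ A : Finset (ZMod p), A.Nonempty ∧ IsNType k A ∧ #A = m})
    ⟨_, univ, univ_nonempty, isNType_univ k, rfl⟩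

theorem exists_isSType_card_eq_S (k : ℕ) :
    ∃ A : Finset (ZMod p), A.Nonempty ∧ IsSType k A ∧ #A = S k p :=
  Nat.sInf_mem (s := {m | ∃ A : Finset (ZMod p), A.Nonempty ∧ IsSType k A ∧ #A = m})
    ⟨_, univ, univ_nonempty, (isNType_univ k).1, rfl⟩

theorem prod_one_sub_single_pow_ne_zero {R : Type*} [CommRing R] [Nontrivial R] [Fintype ι]
    [Fintype κ] (hv : LinearIndependent (ZMod p) v) (hw : LinearIndependent (ZMod p) w)
    {k r : ℕ} (hkr : k * r < p) (hNS : (N k p * S k p) ^ r < p) :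
    (∏ i, (1 - single (v i) 1) ^ (k * r)) * ∏ j, (1 - single (w j) 1) ^ (k * r) ≠
      (0 : AddMonoidAlgebra R V) := by
  obtain ⟨A, hA, hAN, hAcard⟩ := exists_isNType_card_eq_N (p := p) k
  obtain ⟨B, hB, hBS, hBcard⟩ := exists_isSType_card_eq_S (p := p) k
  have h := prod_avoidFactor_mul_prod_avoidFactor_ne_zero (1 : AddChar (ZMod p) R) (α := Fin k)
    (β := Fin r) (by simpa [mul_comm r]) hA (by simpa) hB (by simpa) (by simpa [hAcard, hBcard])
    hv hw 0 0
  simpa [avoidFactor_one, ← pow_mul] using h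

theorem exists_dual_forall_apply_ne [Finite ι] [Finite κ] {α β : Type*} [Fintype α] [Fintype β]
    (hp : Fintype.card β * Fintype.card α < p) {A B : Finset (ZMod p)} (hA : A.Nonempty)
    (hAN : IsNType (Fintype.card α) A) (hB : B.Nonempty) (hBS : IsSType (Fintype.card α) B)
    (hcard : (#A * #B) ^ Fintype.card β < p) (hv : LinearIndependent (ZMod p) v)
    (hw : LinearIndependent (ZMod p) w) (c : ι → β → α → ZMod p) (d : κ → β → α → ZMod p) :
    ∃ f : Dual (ZMod p) V, (∀ i b l, f (v i) ≠ c i b l) ∧ ∀ j b l, f (w j) ≠ d j b l := by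
  cases nonempty_fintype ι
  cases nonempty_fintype κ
  let ψ : AddChar (ZMod p) ℂ := ZMod.stdAddChar
  obtain ⟨f, hf⟩ := exists_evalDual_ne_zero ψ ZMod.injective_stdAddChar
    (prod_avoidFactor_mul_prod_avoidFactor_ne_zero ψ hp hA hAN hB hBS hcard hv hw c d)
  simp only [map_mul, map_prod, mul_ne_zero_iff, prod_ne_zero_iff] at hf
  exact ⟨f, fun i b => apply_ne_of_evalDual_avoidFactor_ne_zero _
      (hf.1 i (mem_univ i) b (mem_univ b)),
    fun j b => apply_ne_of_evalDual_avoidFactor_ne_zero _ (hf.2 j (mem_univ j) b (mem_univ b))⟩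

theorem exists_dual_forall_apply_ne_of_isSType_one [Finite ι] [Finite κ] {A : Finset (ZMod p)}
    (hA : A.Nonempty) (hS : IsSType 1 A) {r : ℕ} (hr : r < p) (hcard : (#A * #A) ^ r < p)
    (hv : LinearIndependent (ZMod p) v) (hw : LinearIndependent (ZMod p) w)
    (c : ι → Fin r → ZMod p) (d : κ → Fin r → ZMod p) :
    ∃ f : Dual (ZMod p) V, (∀ i b, f (v i) ≠ c i b) ∧ ∀ j b, f (w j) ≠ d j b := by
  obtain ⟨f, hfv, hfw⟩ := exists_dual_forall_apply_ne (α := Unit) (β := Fin r) (by simpa) hA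
    (hS.isNType_one hA) hA hS (by simpa) hv hw (fun i b _ => c i b) fun j b _ => d j b
  exact ⟨f, fun i b => hfv i b (), fun j b => hfw j b ()⟩

theorem exists_dual_forall_apply_ne_of_lt [Finite ι] [Finite κ] (h61 : 61 < p) (h79 : p ≠ 79)
    (hv : LinearIndependent (ZMod p) v) (hw : LinearIndependent (ZMod p) w) (c : ι → ZMod p)
    (d : κ → ZMod p) :
    ∃ f : Dual (ZMod p) V, (∀ i, f (v i) ≠ c i) ∧ ∀ j, f (w j) ≠ d j := by
  obtain ⟨A, hA, hS, hcard⟩ := exists_isSType_one_card_mul_card_lt Fact.out h61 h79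
  obtain ⟨f, hfv, hfw⟩ := exists_dual_forall_apply_ne_of_isSType_one hA hS (r := 1) (by lia)
    (by simpa) hv hw (fun i _ => c i) fun j _ => d j
  exact ⟨f, fun i => hfv i 0, fun j => hfw j 0⟩

theorem exists_dual_forall_apply_ne_of_pow_le [Finite ι] [Finite κ] {k : ℕ} (hk : 2 ≤ k)
    (hp : k ^ (20 * k) ≤ p) (hv : LinearIndependent (ZMod p) v) (hw : LinearIndependent (ZMod p) w)
    (c : ι → Fin k → ZMod p) (d : κ → Fin k → ZMod p) :
    ∃ f : Dual (ZMod p) V, (∀ i l, f (v i) ≠ c i l) ∧ ∀ j l, f (w j) ≠ d j l := by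
  have hkp : k < p := (lt_self_pow₀ (by lia) (by lia)).trans_le hp
  exact exists_dual_forall_apply_ne_of_isSType_one halvingSet_nonempty
    (isSType_one_halvingSet (by lia)) hkp (card_halvingSet_mul_self_pow_lt hk hp) hv hw c d

end Avoidance

theorem dual_apply_row {R m n : Type*} [CommSemiring R] [Fintype n] [DecidableEq n]
    (f : Dual R (n → R)) (M : Matrix m n R) (i : m) :
    f (M.row i) = M.mulVec (fun j => f (Pi.single j 1)) i := by
  conv_lhs => rw [pi_eq_sum_univ' (M.row i), map_sum]
  exact sum_congr rfl fun j _ => map_smul f _ _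

end AJT

theorem theorem1_general {V ι κ R : Type*} [AddCommGroup V] {p : ℕ} [Fact p.Prime]
    [Module (ZMod p) V] [Fintype ι] [Fintype κ] [CommRing R] [Nontrivial R] {v : ι → V}
    (hv : LinearIndependent (ZMod p) v) {w : κ → V} (hw : LinearIndependent (ZMod p) w) :
    (∀ k r : ℕ, k * r < p → (AJT.N k p * AJT.S k p) ^ r < p →
      (∏ i, (1 - AddMonoidAlgebra.single (v i) 1) ^ (k * r)) *
        ∏ j, (1 - AddMonoidAlgebra.single (w j) 1) ^ (k * r) ≠ (0 : AddMonoidAlgebra R V)) ∧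
    (61 < p → p ≠ 79 → ∀ (c : ι → ZMod p) (d : κ → ZMod p),
      ∃ f : Module.Dual (ZMod p) V, (∀ i, f (v i) ≠ c i) ∧ ∀ j, f (w j) ≠ d j) ∧
    (∀ k : ℕ, 2 ≤ k → k ^ (20 * k) ≤ p → ∀ (c : ι → Fin k → ZMod p) (d : κ → Fin k → ZMod p),
      ∃ f : Module.Dual (ZMod p) V, (∀ i l, f (v i) ≠ c i l) ∧ ∀ j l, f (w j) ≠ d j l) :=
  ⟨fun _ _ hkr hNS => AJT.prod_one_sub_single_pow_ne_zero hv hw hkr hNS,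
    fun h61 h79 => AJT.exists_dual_forall_apply_ne_of_lt h61 h79 hv hw,
    fun _ hk hp => AJT.exists_dual_forall_apply_ne_of_pow_le hk hp hv hw⟩

theorem theorem1 :
    -- (i)
    (∀ p k n : ℕ, p.Prime → 1 ≤ k → k < p → AJT.N k p * AJT.S k p < p - 1 →
      ∀ M : Matrix (Fin n) (Fin n) (ZMod p), M.det ≠ 0 →
        (∏ i : Fin n, (1 - AJT.g (Pi.single i 1 : Fin n → ZMod p)) ^ k) *
          (∏ i : Fin n, (1 - AJT.g (M.row i)) ^ k) ≠ (0 : AJT.GroupRing p n)) ∧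
    -- (ii)
    (∀ p n : ℕ, p.Prime → 61 < p → p ≠ 79 →
      ∀ M : Matrix (Fin n) (Fin n) (ZMod p), M.det ≠ 0 →
        ∀ c d : Fin n → ZMod p,
          ∃ x : Fin n → ZMod p, (∀ i, x i ≠ c i) ∧ (∀ i, M.mulVec x i ≠ d i)) ∧
    -- (ii), in particular
    (∀ p n : ℕ, p.Prime → 61 < p → p ≠ 79 →
      ∀ M : Matrix (Fin n) (Fin n) (ZMod p), M.det ≠ 0 →
        ∃ x : Fin n → ZMod p, (∀ i, x i ≠ 0) ∧ (∀ i, M.mulVec x i ≠ 0)) ∧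
    -- (iii)
    (∃ K : ℕ, ∀ k : ℕ, 2 ≤ k → ∀ p : ℕ, p.Prime → k ^ (K * k) < p →
      ∀ n : ℕ, ∀ M : Matrix (Fin n) (Fin n) (ZMod p), M.det ≠ 0 →
        ∀ c d : Fin n → Fin k → ZMod p,
          (∀ i, Function.Injective (c i)) → (∀ i, Function.Injective (d i)) →
            ∃ x : Fin n → ZMod p,
              (∀ i l, x i ≠ c i l) ∧ (∀ i l, M.mulVec x i ≠ d i l)) := by
  have general {p n : ℕ} [Fact p.Prime] {M : Matrix (Fin n) (Fin n) (ZMod p)} (hM : M.det ≠ 0) :=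
    theorem1_general (R := ZMod p) (Pi.linearIndependent_single_one (Fin n) (ZMod p))
      (Matrix.linearIndependent_rows_of_det_ne_zero hM)
  have ajt (p n : ℕ) (hp : p.Prime) (h61 : 61 < p) (h79 : p ≠ 79)
      (M : Matrix (Fin n) (Fin n) (ZMod p)) (hM : M.det ≠ 0) (c d : Fin n → ZMod p) :
      ∃ x : Fin n → ZMod p, (∀ i, x i ≠ c i) ∧ (∀ i, M.mulVec x i ≠ d i) := by
    have : Fact p.Prime := ⟨hp⟩
    obtain ⟨f, hfc, hfd⟩ := (general hM).2.1 h61 h79 c d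
    exact ⟨fun j => f (Pi.single j 1), hfc, fun i => AJT.dual_apply_row f M i ▸ hfd i⟩
  refine ⟨fun p k n hp _ hkp hNS M hM => ?_, ajt,
    fun p n hp h61 h79 M hM => ajt p n hp h61 h79 M hM 0 0,
    20, fun k hk p hp hkp n M hM c d _ _ => ?_⟩ <;> have : Fact p.Prime := ⟨hp⟩
  · simpa [AJT.g] using! (general hM).1 k 1 (by lia) (by lia)
  · obtain ⟨f, hfc, hfd⟩ := (general hM).2.2 k hk hkp.le c d
    exact ⟨fun j => f (Pi.single j 1), hfc, fun i => AJT.dual_apply_row f M i ▸ hfd i⟩
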